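/- Let $(W_n)_{n\in\mathbb N}$ be a sequence in which each $W_n$ is one of the classical Weyl groups $S_n$, $B_n$, $D_n$ (the type may vary with $n$), and put $d_{\max}=n,\ 2n,\ 2n-2$ for $W_n=S_n,\ B_n,\ D_n$ respectively. Let $d=d(n)$ be integers with $1\le d\le d_{\max}-1$ for all sufficiently large $n$. For each $n$ let $Z_1,\dots,Z_n$ be independent random variables on a probability space, uniformly distributed on $(0,1)$ if $W_n=S_n$ and on $(-1,1)$ if $W_n=B_n$ or $W_n=D_n$. With $$\mathfrak N_{n,d}=\{(i,j)\in\{1,\dots,n\}^2 : 1\le j-i\le d\},\qquad \widetilde{\mathfrak N}_{n,d}=\{(i,j)\in\{1,\dots,n\}^2 : i<j,\ i+j\le d\},$$ the generalized inversion statistic $X_{\mathrm{inv}}^{(d)}$ is $$\sum_{(i,j)\in\mathfrak N_{n,d}}\mathbf 1\{Z_i>Z_j\}\quad\text{on } S_n,$$ $$\sum_{(i,j)\in\mathfrak N_{n,d}}\mathbf 1\{Z_i>Z_j\}+\sum_{(i,j)\in\widetilde{\mathfrak N}_{n,d}}\mathbf 1\{-Z_i>Z_j\}+\sum_{i=1}^{\min\{n,d\}}\mathbf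 1\{Z_i<0\}\quad\text{on } B_n,$$ $$\sum_{(i,j)\in\mathfrak N_{n,d}}\mathbf 1\{Z_i>Z_j\}+\sum_{(i,j)\in\widetilde{\mathfrak N}_{n,d+2}}\mathbf 1\{-Z_i>Z_j\}\quad\text{on } D_n.$$ Let $$\hat X_{\mathrm{inv}}^{(d)}=\sum_{k=1}^n\mathbb E\bigl(X_{\mathrm{inv}}^{(d)}\mid Z_k\bigr)-(n-1)\,\mathbb E\bigl(X_{\mathrm{inv}}^{(d)}\bigr)$$ be its Hájek projection with respect to $Z_1,\dots,Z_n$. Then, as $n\to\infty$, $$\mathrm{Var}\bigl(\hat X_{\mathrm{inv}}^{(d)}\bigr)\sim\mathrm{Var}\bigl(X_{\mathrm{inv}}^{(d)}\bigr)\quad\text{if and only if}\quad d\gg\sqrt n,\ \text{ i.e. } \lim_{n\to\infty}\sqrt n/d(n)=0.$$ -/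

import Mathlib

open MeasureTheory ProbabilityTheory Filter Asymptotics

/-- The three families of classical Weyl groups: the symmetric groups `S_n`, the signed permutation
groups `B_n` and the even-signed permutation groups `D_n`. -/
inductive WeylFamily
  | S
  | B
  | D

namespace WeylFamily

/-- The largest degree `d_max` of the group of rank index `n` in the family. -/
def dMax : WeylFamily → ℕ → ℕ
  | S, n => n
  | B, n => 2 * n
  | D, n => 2 * n - 2

/-- The range of the uniform variables that represent the group: `(0,1)` for `S_n` and `(-1,1)` for
`B_n` and `D_n`. -/
def range : WeylFamily → Set ℝ
  | S => Set.Ioo 0 1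
  | B => Set.Ioo (-1) 1
  | D => Set.Ioo (-1) 1

end WeylFamily

/-- The pairs `(i, j)` of indices with `1 ≤ j - i ≤ d`: the positive roots `e_i - e_j` of height
at most `d`. The element `i : Fin n` stands for the index `i + 1` in `{1, …, n}`. -/
def diffPairs (n d : ℕ) : Finset (Fin n × Fin n) :=
  Finset.univ.filter fun p => p.1 < p.2 ∧ (p.2 : ℕ) ≤ (p.1 : ℕ) + d

/-- The pairs `(i, j)` of indices with `i < j` and `i + j ≤ d`. The element `i : Fin n` stands for
the index `i + 1` in `{1, …, n}`, hence the shifts by one. -/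
def sumPairs (n d : ℕ) : Finset (Fin n × Fin n) :=
  Finset.univ.filter fun p => p.1 < p.2 ∧ ((p.1 : ℕ) + 1) + ((p.2 : ℕ) + 1) ≤ d

/-- `∑ 1{z_i > z_j}` over the pairs with `1 ≤ j - i ≤ d`. -/
noncomputable def diffInv (n d : ℕ) (z : Fin n → ℝ) : ℝ :=
  ∑ p ∈ diffPairs n d, if z p.1 > z p.2 then 1 else 0

/-- `∑ 1{-z_i > z_j}` over the pairs with `i < j` and `i + j ≤ d`. -/
noncomputable def sumInv (n d : ℕ) (z : Fin n → ℝ) : ℝ :=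
  ∑ p ∈ sumPairs n d, if -z p.1 > z p.2 then 1 else 0

/-- `∑ 1{z_i < 0}` over the indices `1 ≤ i ≤ min n d`. -/
noncomputable def negCount (n d : ℕ) (z : Fin n → ℝ) : ℝ :=
  ∑ i ∈ Finset.univ.filter (fun i : Fin n => (i : ℕ) + 1 ≤ d), if z i < 0 then 1 else 0

/-- The number of `d`-inversions (inversions at positive roots of height at most `d`), as a function
of the values `z_1, …, z_n` of the representing variables. -/
noncomputable def genInv : WeylFamily → (n d : ℕ) → (Fin n → ℝ) → ℝ
  | .S, n, d, z => diffInv n d z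
  | .B, n, d, z => diffInv n d z + sumInv n d z + negCount n d z
  | .D, n, d, z => diffInv n d z + sumInv n (d + 2) z

/-- The Hájek projection `∑ k, E(X | Z_k) - (n - 1) E(X)` of `X` with respect to `Z_1, …, Z_n`. -/
noncomputable def hajekProjection {Ω : Type*} [MeasurableSpace Ω] (μ : Measure Ω) {n : ℕ}
    (Z : Fin n → Ω → ℝ) (X : Ω → ℝ) : Ω → ℝ :=
  fun ω => ∑ k, (μ[X | MeasurableSpace.comap (Z k) (borel ℝ)]) ω - ((n : ℝ) - 1) * ∫ ω', X ω' ∂μ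

/-! ### Integrating out one independent variable -/

section Independence

variable {Ω : Type*} [MeasurableSpace Ω] {μ : Measure Ω}

/-! The proof computes both variances exactly from a Hoeffding decomposition. After `z ↦ 2 * z - 1`
in type S, all variables are uniform on `(-1, 1)`, and the three families become one statistic
`rootInv`. Each inversion indicator splits into its mean, its projections on the two variables
(linear there), and a remainder `kernel` that integrates to zero in each argument. Summing
(`rootInv_eq`) gives a constant, a sum of one-variable functions, and a sum of degenerate kernels
over the roots.

The one-variable part is the centred Hájek projection. The kernels are orthogonal to every function
of one variable and to each other, each with second moment `1/12`; the only delicate pair is `e_i -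
e_j` and `e_i + e_j`, settled by antisymmetry. Hence (`variance_rootInv`) the variance of the
statistic exceeds that of its projection by exactly one twelfth of the number of roots `e_i ± e_j`
counted.

That number is of order `n * d`. The variance of the projection is `O(d ^ 3)`: an index far from
both ends has `d` partners on each side, whose contributions cancel, so only `O(d)` indices carry a
coefficient, of size `O(d)` (`sum_linVar_le`). The last indices attain this order once `8 ≤ d`
(`le_sum_linVar`). So the variances are equivalent iff `n * d` is negligible against `d ^ 3`, that
is, iff `√n = o(d)` (`isEquivalent_add_iff_isLittleO_sqrt`). -/

theorem integral_comp_prod_of_indepFun {E F : Type*} [IsProbabilityMeasure μ] [MeasurableSpace E] [MeasurableSpace F]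
    {A : Ω → E} {Y : Ω → F} (hA : Measurable A) (hY : Measurable Y) (h : IndepFun A Y μ)
    {G : E × F → ℝ} (hG : Measurable G) {C : ℝ} (hC : ∀ p, ‖G p‖ ≤ C) :
    ∫ ω, G (A ω, Y ω) ∂μ = ∫ ω, ∫ ω', G (A ω', Y ω) ∂μ ∂μ := by
  have hmap := (indepFun_iff_map_prod_eq_prod_map_map hA.aemeasurable hY.aemeasurable).1 h
  have : IsProbabilityMeasure (μ.map A) := Measure.isProbabilityMeasure_map hA.aemeasurable
  have : IsProbabilityMeasure (μ.map Y) := Measure.isProbabilityMeasure_map hY.aemeasurable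
  have hint : Integrable G ((μ.map A).prod (μ.map Y)) :=
    Integrable.of_bound hG.aestronglyMeasurable C (ae_of_all _ hC)
  rw [← integral_map (f := G) (hA.prodMk hY).aemeasurable hG.aestronglyMeasurable, hmap,
    integral_prod_symm _ hint, integral_map hY.aemeasurable]
  · refine integral_congr_ae (ae_of_all _ fun ω => ?_)
    exact integral_map hA.aemeasurable (hG.comp measurable_prodMk_right).aestronglyMeasurable
  · exact hG.stronglyMeasurable.integral_prod_left'.aestronglyMeasurable

variable {ι : Type*} {U : ι → Ω → ℝ}

/-- The indices `j`, `a`, `b` may coincide with one another, so independence is taken from the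
family indexed by the finset `{j, a, b}`. -/
theorem indepFun_triple (hU : ∀ i, Measurable (U i)) (hind : iIndepFun U μ) {i j a b : ι}
    (hij : i ≠ j) (hia : i ≠ a) (hib : i ≠ b) :
    IndepFun (U i) (fun ω => (U j ω, U a ω, U b ω)) μ := by
  classical
  have hdisj : Disjoint ({i} : Finset ι) {j, a, b} := by
    simp [hij, hia, hib]
  have h := hind.indepFun_finset {i} {j, a, b} hdisj hU
  have h1 : Measurable (fun v : (({i} : Finset ι) → ℝ) => v ⟨i, by simp⟩) := measurable_pi_apply _
  have h2 : Measurable (fun v : (({j, a, b} : Finset ι) → ℝ) =>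
      (v ⟨j, by simp⟩, v ⟨a, by simp⟩, v ⟨b, by simp⟩)) := by fun_prop
  exact h.comp h1 h2

/-- A kernel that integrates to zero in its first argument is uncorrelated with every function of
variables other than the first one. -/
theorem integral_degenerate_mul_eq_zero [IsProbabilityMeasure μ]
    (hU : ∀ i, Measurable (U i)) (hind : iIndepFun U μ)
    {i j a b : ι} (hij : i ≠ j) (hia : i ≠ a) (hib : i ≠ b) {g h : ℝ → ℝ → ℝ}
    (hg : Measurable fun p : ℝ × ℝ => g p.1 p.2) (hh : Measurable fun p : ℝ × ℝ => h p.1 p.2)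
    {C D : ℝ} (hgC : ∀ x y, ‖g x y‖ ≤ C) (hhD : ∀ x y, ‖h x y‖ ≤ D)
    (hdeg : ∀ y, ∫ ω, g (U i ω) y ∂μ = 0) :
    ∫ ω, g (U i ω) (U j ω) * h (U a ω) (U b ω) ∂μ = 0 := by
  have key := integral_comp_prod_of_indepFun (hU i)
    ((hU j).prodMk ((hU a).prodMk (hU b))) (indepFun_triple hU hind hij hia hib)
    (G := fun p => g p.1 p.2.1 * h p.2.2.1 p.2.2.2)
    ((hg.comp (measurable_fst.prodMk measurable_snd.fst)).mul
      (hh.comp (measurable_snd.snd.fst.prodMk measurable_snd.snd.snd))) (C := C * D)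
    (fun p => by
      rw [norm_mul]
      exact mul_le_mul (hgC _ _) (hhD _ _) (norm_nonneg _) ((norm_nonneg _).trans (hgC 0 0)))
  simp only at key
  rw [key]
  simp [integral_mul_const, hdeg]

end Independence

/-! ### Hájek projection and variance from a Hoeffding decomposition -/

section Hajek

variable {Ω : Type*} [mΩ : MeasurableSpace Ω] {μ : Measure Ω} {n : ℕ}
  {U : Fin n → Ω → ℝ} {f : Fin n → ℝ → ℝ} {R : Ω → ℝ} {m : ℝ}

theorem memLp_two_of_bound [IsProbabilityMeasure μ] {R : Ω → ℝ} (hR : Measurable R) (hRC : ∃ C, ∀ ω, ‖R ω‖ ≤ C) :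
    MemLp R 2 μ := by
  obtain ⟨C, hC⟩ := hRC
  exact MemLp.of_bound hR.aestronglyMeasurable C (ae_of_all _ hC)

theorem integral_comp_mul_comp_eq_zero (hU : ∀ i, Measurable (U i)) (hind : iIndepFun U μ)
    (hf : ∀ k, Measurable (f k)) (hf0 : ∀ k, ∫ ω, f k (U k ω) ∂μ = 0)
    {φ : ℝ → ℝ} (hφ : Measurable φ) {k l : Fin n} (hkl : l ≠ k) :
    ∫ ω, f l (U l ω) * φ (U k ω) ∂μ = 0 := by
  have h := ((hind.indepFun hkl).comp (hf l) hφ).integral_fun_mul_eq_mul_integral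
    ((hf l).comp (hU l)).aestronglyMeasurable (hφ.comp (hU k)).aestronglyMeasurable
  simp only [Function.comp_apply] at h
  rw [h, hf0, zero_mul]

/-- Conditioning on `U k` kills every other `f l` because it is centred and independent of `U k`,
and kills `R` because it is orthogonal to functions of `U k`. Both facts are tested on events `U k
⁻¹' B`, with `φ` the indicator of `B`. -/
theorem condExp_hoeffding [IsProbabilityMeasure μ]
    (hU : ∀ i, Measurable (U i)) (hind : iIndepFun U μ)
    (hf : ∀ k, Measurable (f k)) (hfC : ∀ k, ∃ C, ∀ x, ‖f k x‖ ≤ C)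
    (hf0 : ∀ k, ∫ ω, f k (U k ω) ∂μ = 0) (hR : Measurable R) (hRC : ∃ C, ∀ ω, ‖R ω‖ ≤ C)
    (hR0 : ∀ k (φ : ℝ → ℝ), Measurable φ → (∀ x, ‖φ x‖ ≤ 1) → ∫ ω, R ω * φ (U k ω) ∂μ = 0)
    (k : Fin n) :
    μ[fun ω => m + ∑ l, f l (U l ω) + R ω | MeasurableSpace.comap (U k) (borel ℝ)]
      =ᵐ[μ] fun ω => m + f k (U k ω) := by
  have hle : MeasurableSpace.comap (U k) (borel ℝ) ≤ mΩ := (hU k).comap_le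
  have hfi : ∀ l, Integrable (fun ω => f l (U l ω)) μ := fun l =>
    (memLp_two_of_bound ((hf l).comp (hU l))
      ((hfC l).imp fun C hC ω => hC (U l ω))).integrable (by norm_num)
  have hRi : Integrable R μ := (memLp_two_of_bound hR hRC).integrable (by norm_num)
  have hsum : Integrable (fun ω => ∑ l, f l (U l ω)) μ := integrable_finsetSum _ fun l _ => hfi l
  have hms : Integrable (fun ω => m + ∑ l, f l (U l ω)) μ := (integrable_const m).add hsum
  symm
  refine ae_eq_condExp_of_forall_setIntegral_eq hle ?_ ?_ ?_ ?_
  · exact ((integrable_const m).add hsum).add hRi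
  · intro s _ _
    exact ((integrable_const m).add (hfi k)).integrableOn
  · rintro s ⟨B, hB, rfl⟩ -
    have hB' : MeasurableSet B := hB
    have hs : MeasurableSet (U k ⁻¹' B) := hU k hB'
    set φ : ℝ → ℝ := B.indicator 1 with hφdef
    have hφ : Measurable φ := measurable_one.indicator hB'
    have hφ1 : ∀ x, ‖φ x‖ ≤ 1 := fun x => by
      by_cases hx : x ∈ B <;> simp [hφdef, hx]
    have conv : ∀ G : Ω → ℝ, ∫ ω in U k ⁻¹' B, G ω ∂μ = ∫ ω, G ω * φ (U k ω) ∂μ := by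
      intro G
      rw [← integral_indicator hs]
      refine integral_congr_ae (ae_of_all _ fun ω => ?_)
      by_cases hx : U k ω ∈ B <;> simp [hφdef, hx]
    have hl : ∀ l, l ≠ k → ∫ ω in U k ⁻¹' B, f l (U l ω) ∂μ = 0 := fun l hlk => by
      rw [conv]; exact integral_comp_mul_comp_eq_zero hU hind hf hf0 hφ hlk
    have hr : ∫ ω in U k ⁻¹' B, R ω ∂μ = 0 := by rw [conv]; exact hR0 k φ hφ hφ1
    rw [integral_add (integrable_const m) (hfi k).integrableOn,
      integral_add hms.integrableOn hRi.integrableOn, hr, add_zero,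
      integral_add (integrable_const m) hsum.integrableOn,
      integral_finsetSum _ fun l _ => (hfi l).integrableOn,
      Finset.sum_eq_single k (fun l _ hlk => hl l hlk) (by simp)]
  · have h1 : Measurable[MeasurableSpace.comap (U k) (borel ℝ)] (U k) := comap_measurable _
    have h2 : Measurable[MeasurableSpace.comap (U k) (borel ℝ)] fun ω => m + f k (U k ω) :=
      ((hf k).const_add m).comp h1
    exact h2.stronglyMeasurable.aestronglyMeasurable

/-- Pythagoras: the `f l (U l)` are independent and centred, and `R` is orthogonal to each of them.
-/
theorem variance_hoeffding [IsProbabilityMeasure μ]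
    (hU : ∀ i, Measurable (U i)) (hind : iIndepFun U μ)
    (hf : ∀ k, Measurable (f k)) (hfC : ∀ k, ∃ C, ∀ x, ‖f k x‖ ≤ C)
    (hf0 : ∀ k, ∫ ω, f k (U k ω) ∂μ = 0) (hR : Measurable R) (hRC : ∃ C, ∀ ω, ‖R ω‖ ≤ C)
    (hR0 : ∀ k (φ : ℝ → ℝ), Measurable φ → (∃ C, ∀ x, ‖φ x‖ ≤ C) →
      ∫ ω, R ω * φ (U k ω) ∂μ = 0) (hRint : ∫ ω, R ω ∂μ = 0) :
    variance (fun ω => m + ∑ l, f l (U l ω) + R ω) μ =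
      ∑ l, ∫ ω, f l (U l ω) ^ 2 ∂μ + ∫ ω, R ω ^ 2 ∂μ := by
  have hfL : ∀ l, MemLp (fun ω => f l (U l ω)) 2 μ := fun l =>
    memLp_two_of_bound ((hf l).comp (hU l)) ((hfC l).imp fun C hC ω => hC (U l ω))
  have hRL : MemLp R 2 μ := memLp_two_of_bound hR hRC
  have hsumL : MemLp (fun ω => ∑ l, f l (U l ω)) 2 μ := memLp_finsetSum _ fun l _ => hfL l
  have hfi := fun l => (hfL l).integrable one_le_two
  have hsum := hsumL.integrable one_le_two
  have hsum0 : ∫ ω, ∑ l, f l (U l ω) ∂μ = 0 := by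
    rw [integral_finsetSum _ fun l _ => hfi l]
    simp [hf0]
  have h0 : (fun ω => m + ∑ l, f l (U l ω) + R ω) = fun ω => m + (∑ l, f l (U l ω) + R ω) := by
    funext ω; ring
  have hadd : AEStronglyMeasurable (fun ω => ∑ l, f l (U l ω) + R ω) μ :=
    (hsumL.add hRL).aestronglyMeasurable
  rw [h0, variance_const_add hadd,
    variance_fun_add hsumL hRL]
  have hcov : cov[fun ω => ∑ l, f l (U l ω), R; μ] = 0 := by
    rw [covariance_eq_sub hsumL hRL, hRint, mul_zero, sub_zero]
    have : ((fun ω => ∑ l, f l (U l ω)) * R) = fun ω => ∑ l, R ω * f l (U l ω) := by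
      funext ω
      rw [Pi.mul_apply, mul_comm, Finset.mul_sum]
    have hi : ∀ l, Integrable (fun ω => R ω * f l (U l ω)) μ := fun l => hRL.integrable_mul (hfL l)
    simp only [this]
    rw [integral_finsetSum _ fun l _ => hi l]
    exact Finset.sum_eq_zero fun l _ => hR0 l (f l) (hf l) (hfC l)
  have hvR : variance R μ = ∫ ω, R ω ^ 2 ∂μ := by
    rw [variance_of_integral_eq_zero hR.aemeasurable hRint]
  have hvf : variance (fun ω => ∑ l, f l (U l ω)) μ = ∑ l, ∫ ω, f l (U l ω) ^ 2 ∂μ := by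
    have h1 : (fun ω => ∑ l, f l (U l ω)) = ∑ l, fun ω => f l (U l ω) := by
      funext ω; simp
    rw [h1, IndepFun.variance_sum (fun l _ => hfL l)]
    · exact Finset.sum_congr rfl fun l _ =>
        variance_of_integral_eq_zero ((hf l).comp (hU l)).aemeasurable (hf0 l)
    · intro a _ b _ hab
      exact (hind.indepFun hab).comp (hf a) (hf b)
  rw [hcov, hvR, hvf]
  ring

/-- The Hájek projection of a statistic with Hoeffding decomposition `m + ∑ f_l(U_l) + R`. -/
theorem hajekProjection_hoeffding [IsProbabilityMeasure μ]
    (hU : ∀ i, Measurable (U i)) (hind : iIndepFun U μ)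
    (hf : ∀ k, Measurable (f k)) (hfC : ∀ k, ∃ C, ∀ x, ‖f k x‖ ≤ C)
    (hf0 : ∀ k, ∫ ω, f k (U k ω) ∂μ = 0) (hR : Measurable R) (hRC : ∃ C, ∀ ω, ‖R ω‖ ≤ C)
    (hR0 : ∀ k (φ : ℝ → ℝ), Measurable φ → (∃ C, ∀ x, ‖φ x‖ ≤ C) →
      ∫ ω, R ω * φ (U k ω) ∂μ = 0) (hRint : ∫ ω, R ω ∂μ = 0) :
    hajekProjection μ U (fun ω => m + ∑ l, f l (U l ω) + R ω)
      =ᵐ[μ] fun ω => m + ∑ l, f l (U l ω) := by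
  have hfi : ∀ l, Integrable (fun ω => f l (U l ω)) μ := fun l =>
    (memLp_two_of_bound ((hf l).comp (hU l))
      ((hfC l).imp fun C hC ω => hC (U l ω))).integrable one_le_two
  have hRi : Integrable R μ := (memLp_two_of_bound hR hRC).integrable one_le_two
  have hsum : Integrable (fun ω => ∑ l, f l (U l ω)) μ := integrable_finsetSum _ fun l _ => hfi l
  have hms : Integrable (fun ω => m + ∑ l, f l (U l ω)) μ := (integrable_const m).add hsum
  have hmean : ∫ ω, (m + ∑ l, f l (U l ω) + R ω) ∂μ = m := by
    rw [integral_add hms hRi,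
      integral_add (integrable_const m) hsum, integral_finsetSum _ fun l _ => hfi l]
    simp [hf0, hRint]
  have hc := fun k => condExp_hoeffding (m := m) hU hind hf hfC hf0 hR hRC
    (fun k φ hφ h1 => hR0 k φ hφ ⟨1, h1⟩) k
  filter_upwards [ae_all_iff.2 hc] with ω hω
  simp only [hajekProjection, hmean, hω, Finset.sum_add_distrib, Finset.sum_const,
    Finset.card_univ, Fintype.card_fin, nsmul_eq_mul]
  ring

end Hajek

/-! ### Number of roots at a given index -/

/-- The number of pairs in `P` with first entry `k`. -/
def fstCount {n : ℕ} (P : Finset (Fin n × Fin n)) (k : Fin n) : ℕ :=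
  (P.filter fun p => p.1 = k).card

/-- The number of pairs in `P` with second entry `k`. -/
def sndCount {n : ℕ} (P : Finset (Fin n × Fin n)) (k : Fin n) : ℕ :=
  (P.filter fun p => p.2 = k).card

theorem sum_fst_eq {n : ℕ} (P : Finset (Fin n × Fin n)) (φ : Fin n → ℝ) :
    ∑ p ∈ P, φ p.1 = ∑ k, (fstCount P k : ℝ) * φ k := by
  rw [← Finset.sum_fiberwise P (fun p => p.1)]
  refine Finset.sum_congr rfl fun k _ => ?_
  rw [Finset.sum_congr rfl (g := fun _ => φ k)
    (fun p hp => by rw [(Finset.mem_filter.1 hp).2])]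
  simp [fstCount]

theorem sum_snd_eq {n : ℕ} (P : Finset (Fin n × Fin n)) (φ : Fin n → ℝ) :
    ∑ p ∈ P, φ p.2 = ∑ k, (sndCount P k : ℝ) * φ k := by
  rw [← Finset.sum_fiberwise P (fun p => p.2)]
  refine Finset.sum_congr rfl fun k _ => ?_
  rw [Finset.sum_congr rfl (g := fun _ => φ k)
    (fun p hp => by rw [(Finset.mem_filter.1 hp).2])]
  simp [sndCount]

theorem fstCount_diffPairs (n d : ℕ) (k : Fin n) :
    fstCount (diffPairs n d) k = min d (n - 1 - k) := by
  have : fstCount (diffPairs n d) k = (Finset.Ioc (k : ℕ) (min (k + d) (n - 1))).card := by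
    refine Finset.card_bij (fun p _ => (p.2 : ℕ)) ?_ ?_ ?_
    · rintro ⟨a, b⟩ h
      simp only [diffPairs, Finset.mem_filter, Finset.mem_univ, true_and] at h
      obtain ⟨⟨h1, h2⟩, rfl⟩ := h
      have := b.2
      simp only [Finset.mem_Ioc, le_min_iff]
      rw [Fin.lt_def] at h1
      omega
    · rintro ⟨a, b⟩ h ⟨a', b'⟩ h' e
      have h1 := (Finset.mem_filter.1 h).2
      have h2 := (Finset.mem_filter.1 h').2
      simp only at h1 h2 e
      rw [h1, h2, Fin.ext e]
    · intro b hb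
      simp only [Finset.mem_Ioc, le_min_iff] at hb
      have hk := k.2
      refine ⟨(k, ⟨b, by omega⟩), ?_, rfl⟩
      simp only [diffPairs, Finset.mem_filter, Finset.mem_univ, true_and, Fin.lt_def, and_true]
      omega
  rw [this, Nat.card_Ioc]
  have := k.2
  omega

theorem sndCount_diffPairs (n d : ℕ) (k : Fin n) :
    sndCount (diffPairs n d) k = min d k := by
  have : sndCount (diffPairs n d) k = (Finset.Ico ((k : ℕ) - d) k).card := by
    refine Finset.card_bij (fun p _ => (p.1 : ℕ)) ?_ ?_ ?_
    · rintro ⟨a, b⟩ h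
      simp only [diffPairs, Finset.mem_filter, Finset.mem_univ, true_and] at h
      obtain ⟨⟨h1, h2⟩, rfl⟩ := h
      simp only [Finset.mem_Ico]
      rw [Fin.lt_def] at h1
      omega
    · rintro ⟨a, b⟩ h ⟨a', b'⟩ h' e
      have h1 := (Finset.mem_filter.1 h).2
      have h2 := (Finset.mem_filter.1 h').2
      simp only at h1 h2 e
      rw [h1, h2, Fin.ext e]
    · intro a ha
      simp only [Finset.mem_Ico] at ha
      have hk := k.2
      refine ⟨(⟨a, by omega⟩, k), ?_, rfl⟩
      simp only [diffPairs, Finset.mem_filter, Finset.mem_univ, true_and, Fin.lt_def, and_true]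
      omega
  rw [this, Nat.card_Ico]
  omega

/-- A crude bound suffices: it is used for upper estimates of order `d`, and its truncated
subtraction gives zero once `e ≤ k`. -/
theorem fstCount_sumPairs_le (n e : ℕ) (k : Fin n) : fstCount (sumPairs n e) k ≤ e - k := by
  rw [← Finset.card_range (e - k)]
  refine Finset.card_le_card_of_injOn (fun p => (p.2 : ℕ)) ?_ ?_
  · rintro ⟨a, b⟩ h
    simp only [sumPairs, Finset.coe_filter, Finset.mem_filter, Finset.mem_univ, true_and,
      Set.mem_ofPred_eq] at h
    obtain ⟨⟨h1, h2⟩, rfl⟩ := h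
    simp only [Finset.coe_range, Set.mem_Iio]
    omega
  · rintro ⟨a, b⟩ h ⟨a', b'⟩ h' e
    have h1 := (Finset.mem_filter.1 h).2
    have h2 := (Finset.mem_filter.1 h').2
    simp only at h1 h2 e
    rw [h1, h2, Fin.ext e]

theorem sndCount_sumPairs_le (n e : ℕ) (k : Fin n) : sndCount (sumPairs n e) k ≤ e - k := by
  rw [← Finset.card_range (e - k)]
  refine Finset.card_le_card_of_injOn (fun p => (p.1 : ℕ)) ?_ ?_
  · rintro ⟨a, b⟩ h
    simp only [sumPairs, Finset.coe_filter, Finset.mem_filter, Finset.mem_univ, true_and,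
      Set.mem_ofPred_eq] at h
    obtain ⟨⟨h1, h2⟩, rfl⟩ := h
    simp only [Finset.coe_range, Set.mem_Iio]
    omega
  · rintro ⟨a, b⟩ h ⟨a', b'⟩ h' e
    have h1 := (Finset.mem_filter.1 h).2
    have h2 := (Finset.mem_filter.1 h').2
    simp only at h1 h2 e
    rw [h1, h2, Fin.ext e]

theorem card_eq_sum_fstCount {n : ℕ} (P : Finset (Fin n × Fin n)) :
    (P.card : ℝ) = ∑ k, (fstCount P k : ℝ) := by
  simpa using sum_fst_eq P fun _ => 1

/-! ### Order of the variance of the projection -/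

/-- Twice the coefficient of the `k`-th variable in the linear part of the statistic
`diffInv n d + sumInv n e`. -/
def linCoeff (n d e : ℕ) (k : Fin n) : ℝ :=
  fstCount (diffPairs n d) k - sndCount (diffPairs n d) k
    - fstCount (sumPairs n e) k - sndCount (sumPairs n e) k

/-- The contribution of the `k`-th variable to twelve times the variance of the Hájek projection of
`diffInv n d + sumInv n e + negCount n f`. -/
noncomputable def linVar (n d e f : ℕ) (k : Fin n) : ℝ :=
  linCoeff n d e k ^ 2 + if (k : ℕ) + 1 ≤ f then 3 - 3 * linCoeff n d e k else 0

theorem abs_linCoeff_le {n d e : ℕ} (hde : e ≤ d + 2) (hd : 1 ≤ d) (k : Fin n) :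
    |linCoeff n d e k| ≤ 7 * d := by
  have h1 : fstCount (diffPairs n d) k ≤ d := by rw [fstCount_diffPairs]; omega
  have h2 : sndCount (diffPairs n d) k ≤ d := by rw [sndCount_diffPairs]; omega
  have h3 := fstCount_sumPairs_le n e k
  have h4 := sndCount_sumPairs_le n e k
  have h3' : fstCount (sumPairs n e) k ≤ 3 * d := by omega
  have h4' : sndCount (sumPairs n e) k ≤ 3 * d := by omega
  rify at h1 h2 h3' h4'
  have := (fstCount (diffPairs n d) k).cast_nonneg (α := ℝ)
  have := (sndCount (diffPairs n d) k).cast_nonneg (α := ℝ)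
  have := (fstCount (sumPairs n e) k).cast_nonneg (α := ℝ)
  have := (sndCount (sumPairs n e) k).cast_nonneg (α := ℝ)
  rw [linCoeff, abs_le]
  constructor <;> linarith

/-- An interior index is first entry of `d` difference roots and second entry of `d` others, and
these cancel; it is too large to occur in a sum root. -/
theorem linCoeff_eq_zero {n d e : ℕ} {k : Fin n} (hk : d ≤ k) (hke : e ≤ k) (hkn : k + d < n) :
    linCoeff n d e k = 0 := by
  have h1 : fstCount (diffPairs n d) k = d := by rw [fstCount_diffPairs]; omega
  have h2 : sndCount (diffPairs n d) k = d := by rw [sndCount_diffPairs]; omega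
  have h3 := fstCount_sumPairs_le n e k
  have h4 := sndCount_sumPairs_le n e k
  have h3' : fstCount (sumPairs n e) k = 0 := by omega
  have h4' : sndCount (sumPairs n e) k = 0 := by omega
  simp [linCoeff, h1, h2, h3', h4']

/-- Near the right end there are at most `d / 8` partners to the right, but at least `d / 4` to the
left, since `k ≥ n - 1 - d / 8` with `d ≤ 2 * n` and `8 ≤ d`. Sum roots enter with a negative sign,
so they only help. -/
theorem linCoeff_le {n d e : ℕ} (hdn : d ≤ 2 * n) (hd8 : 8 ≤ d) {k : Fin n}
    (hk : n ≤ k + 1 + d / 8) : linCoeff n d e k ≤ -(d / 8) := by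
  have h1 := fstCount_diffPairs n d k
  have h2 := sndCount_diffPairs n d k
  have h : d + 8 * fstCount (diffPairs n d) k ≤ 8 * sndCount (diffPairs n d) k := by
    have := k.2
    omega
  rify at h
  have := (fstCount (sumPairs n e) k).cast_nonneg (α := ℝ)
  have := (sndCount (sumPairs n e) k).cast_nonneg (α := ℝ)
  rw [linCoeff]
  linarith

theorem linVar_nonneg (n d e f : ℕ) (k : Fin n) : 0 ≤ linVar n d e f k := by
  rw [linVar]
  split_ifs
  -- `4 * (c ^ 2 - 3 * c + 3) = (2 * c - 3) ^ 2 + 3`.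
  · nlinarith [sq_nonneg (2 * linCoeff n d e k - 3)]
  · positivity

theorem linVar_le {n d e f : ℕ} (hde : e ≤ d + 2) (hd : 1 ≤ d) (k : Fin n) :
    linVar n d e f k ≤ 73 * d ^ 2 := by
  have h := abs_linCoeff_le hde hd k
  have h2 : linCoeff n d e k ^ 2 ≤ (7 * d) ^ 2 := sq_le_sq' (abs_le.1 h).1 (abs_le.1 h).2
  have hd' : (1 : ℝ) ≤ d := by exact_mod_cast hd
  rw [linVar]
  split_ifs
  -- The constant is `73 = 49 + 21 + 3`, from `c ^ 2`, `-3 * c` and `3` with `|c| ≤ 7 * d` and `1 ≤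
  -- d`.
  · nlinarith [(abs_le.1 h).1]
  · nlinarith

theorem linVar_eq_zero {n d e f : ℕ} {k : Fin n} (hk : d ≤ k) (hke : e ≤ k) (hkf : f ≤ k)
    (hkn : k + d < n) : linVar n d e f k = 0 := by
  rw [linVar, linCoeff_eq_zero hk hke hkn, if_neg (by omega)]
  simp

theorem sum_linVar_le {n d e f : ℕ} (hde : e ≤ d + 2) (hdf : f ≤ d) (hd : 1 ≤ d) :
    ∑ k, linVar n d e f k ≤ 292 * d ^ 3 := by
  -- Only indices within `3 * d` of the left end (as `e ≤ d + 2 ≤ 3 * d`) or `d` of the right end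
  -- contribute: at most `4 * d` terms of size `73 * d ^ 2`.
  classical
  set A : Finset (Fin n) := Finset.univ.filter fun k => (k : ℕ) < 3 * d ∨ n ≤ k + d with hA
  have hcard : A.card ≤ 4 * d := by
    have h : A.card ≤ (Finset.range (3 * d) ∪ Finset.Ico (n - d) n).card := by
      refine Finset.card_le_card_of_injOn (fun k => (k : ℕ)) ?_ ?_
      · intro k hk
        have := k.2
        simp only [hA, Finset.coe_filter, Finset.mem_univ, true_and, Set.mem_ofPred_eq] at hk
        simp only [Finset.coe_union, Set.mem_union, Finset.coe_range, Set.mem_Iio, Finset.coe_Ico,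
          Set.mem_Ico]
        omega
      · intro a _ b _ hab
        exact Fin.ext hab
    refine h.trans ((Finset.card_union_le _ _).trans ?_)
    rw [Finset.card_range, Nat.card_Ico]
    omega
  have hsub : ∑ k, linVar n d e f k = ∑ k ∈ A, linVar n d e f k := by
    symm
    refine Finset.sum_subset (Finset.subset_univ _) fun k _ hk => ?_
    simp only [hA, Finset.mem_filter, Finset.mem_univ, true_and, not_or, not_lt, not_le] at hk
    exact linVar_eq_zero (by omega) (by omega) (by omega) (by omega)
  rw [hsub]
  calc ∑ k ∈ A, linVar n d e f k ≤ A.card • (73 * (d : ℝ) ^ 2) :=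
        Finset.sum_le_card_nsmul _ _ _ fun k _ => linVar_le hde hd k
    _ ≤ ((4 * d : ℕ) : ℝ) * (73 * (d : ℝ) ^ 2) := by
        rw [nsmul_eq_mul]; gcongr
    _ = 292 * (d : ℝ) ^ 3 := by push_cast; ring

theorem le_sum_linVar {n d e f : ℕ} (hdn : d ≤ 2 * n) (hd8 : 8 ≤ d) :
    (d : ℝ) ^ 3 / 512 ≤ ∑ k, linVar n d e f k := by
  classical
  set A : Finset (Fin n) := Finset.univ.filter fun k => n ≤ k + 1 + d / 8 with hA
  have hcard : d ≤ 8 * A.card := by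
    have h : (Finset.Ico (n - 1 - d / 8) n).card ≤ A.card := by
      refine Finset.card_le_card_of_surjOn (fun k => (k : ℕ)) ?_
      intro a ha
      simp only [Finset.coe_Ico, Set.mem_Ico] at ha
      refine ⟨⟨a, ha.2⟩, ?_, rfl⟩
      simp only [hA, Finset.coe_filter, Finset.mem_univ, true_and, Set.mem_ofPred_eq]
      omega
    rw [Nat.card_Ico] at h
    omega
  -- The coefficient is negative here, so the cross term `-3 * c` cannot reduce the square.
  have hk : ∀ k ∈ A, (d : ℝ) ^ 2 / 64 ≤ linVar n d e f k := by
    intro k hk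
    have hc : linCoeff n d e k ≤ -(d / 8) :=
      linCoeff_le hdn hd8 (Finset.mem_filter.1 hk).2
    have hd0 : (0 : ℝ) ≤ d := d.cast_nonneg
    rw [linVar]
    split_ifs <;> nlinarith
  rify at hcard
  calc (d : ℝ) ^ 3 / 512 = (d / 8) * (d ^ 2 / 64) := by ring
    _ ≤ A.card * ((d : ℝ) ^ 2 / 64) := by gcongr; linarith
    _ = A.card • ((d : ℝ) ^ 2 / 64) := by rw [nsmul_eq_mul]
    _ ≤ ∑ k ∈ A, linVar n d e f k := Finset.card_nsmul_le_sum _ _ _ hk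
    _ ≤ ∑ k, linVar n d e f k :=
        Finset.sum_le_sum_of_subset_of_nonneg (Finset.subset_univ _)
          fun k _ _ => linVar_nonneg n d e f k

/-! ### The number of roots is of order `n * d` -/

theorem card_diffPairs_add_card_sumPairs_le {n d e : ℕ} (hde : e ≤ d + 2) (hd : 1 ≤ d) :
    ((diffPairs n d).card : ℝ) + (sumPairs n e).card ≤ 4 * (n * d) := by
  rw [card_eq_sum_fstCount, card_eq_sum_fstCount, ← Finset.sum_add_distrib]
  have : ∀ k ∈ (Finset.univ : Finset (Fin n)),
      (fstCount (diffPairs n d) k : ℝ) + fstCount (sumPairs n e) k ≤ 4 * d := by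
    intro k _
    have h1 : fstCount (diffPairs n d) k ≤ d := by rw [fstCount_diffPairs]; omega
    have h3 := fstCount_sumPairs_le n e k
    have : fstCount (diffPairs n d) k + fstCount (sumPairs n e) k ≤ 4 * d := by omega
    exact_mod_cast this
  refine (Finset.sum_le_card_nsmul _ _ _ this).trans (le_of_eq ?_)
  simp
  ring

/-- Each index in the first half has at least `min d (n / 4) ≥ d / 8` partners to its right. -/
theorem le_card_diffPairs {n d : ℕ} (hdn : d ≤ 2 * n) (hn : 2 ≤ n) :
    (n * d : ℝ) / 16 ≤ (diffPairs n d).card := by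
  classical
  set A : Finset (Fin n) := Finset.univ.filter fun k => 2 * (k : ℕ) < n with hA
  have hcard : n ≤ 2 * A.card := by
    have h : (Finset.range ((n + 1) / 2)).card ≤ A.card := by
      refine Finset.card_le_card_of_surjOn (fun k => (k : ℕ)) ?_
      intro a ha
      simp only [Finset.coe_range, Set.mem_Iio] at ha
      refine ⟨⟨a, by omega⟩, ?_, rfl⟩
      simp only [hA, Finset.coe_filter, Finset.mem_univ, true_and, Set.mem_ofPred_eq]
      omega
    rw [Finset.card_range] at h
    omega
  have hk : ∀ k ∈ A, (d : ℝ) / 8 ≤ fstCount (diffPairs n d) k := by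
    intro k hk
    have h1 := (Finset.mem_filter.1 hk).2
    have h2 := fstCount_diffPairs n d k
    have : d ≤ 8 * fstCount (diffPairs n d) k := by omega
    rify at this
    linarith
  rify at hcard
  rw [card_eq_sum_fstCount]
  calc (n * d : ℝ) / 16 = (n / 2) * (d / 8) := by ring
    _ ≤ A.card * ((d : ℝ) / 8) := by gcongr; linarith
    _ = A.card • ((d : ℝ) / 8) := by rw [nsmul_eq_mul]
    _ ≤ ∑ k ∈ A, (fstCount (diffPairs n d) k : ℝ) := Finset.card_nsmul_le_sum _ _ _ hk
    _ ≤ ∑ k, (fstCount (diffPairs n d) k : ℝ) :=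
        Finset.sum_le_sum_of_subset_of_nonneg (Finset.subset_univ _) fun k _ _ => by positivity

/-! ### The degenerate kernel of a root -/

/-- The projection of the real line onto `[-1, 1]`. -/
noncomputable def clamp (x : ℝ) : ℝ := max (-1) (min 1 x)

theorem measurable_clamp : Measurable clamp := by
  unfold clamp; fun_prop

/-- Boundedness on all of `ℝ` is what `clamp` is for: it equals the identity where the variables
live, and integrability needs no restriction of the domain. -/
theorem abs_clamp_le (x : ℝ) : |clamp x| ≤ 1 := by
  rw [abs_le]
  exact ⟨le_max_left _ _, max_le (by norm_num) (min_le_left _ _)⟩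

theorem clamp_of_mem {x : ℝ} (h1 : -1 ≤ x) (h2 : x ≤ 1) : clamp x = x := by
  rw [clamp, min_eq_right h2, max_eq_right h1]

theorem clamp_neg (x : ℝ) : clamp (-x) = -clamp x := by
  unfold clamp
  rcases le_total x 1 with h | h <;> rcases le_total (-1) x with h' | h'
  · rw [min_eq_right h, max_eq_right h', min_eq_right (by linarith), max_eq_right (by linarith)]
  · rw [min_eq_right h, max_eq_left h', min_eq_left (by linarith), max_eq_right (by linarith)]
    ring
  · rw [min_eq_left h, max_eq_right (by norm_num : (-1 : ℝ) ≤ 1), min_eq_right (by linarith),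
      max_eq_left (by linarith)]
  · linarith

theorem clamp_sign_mul {s : ℝ} (hs : s = 1 ∨ s = -1) (x : ℝ) : clamp (s * x) = s * clamp x := by
  rcases hs with rfl | rfl <;> simp [clamp_neg]

theorem intervalIntegrable_of_bound {f : ℝ → ℝ} (hf : Measurable f) {C : ℝ} (hC : ∀ x, |f x| ≤ C)
    (a b : ℝ) : IntervalIntegrable f volume a b :=
  (intervalIntegrable_const (c := C)).mono_fun hf.aestronglyMeasurable
    (ae_of_all _ fun x => by
      simp only [Real.norm_eq_abs]
      exact (hC x).trans (le_abs_self C))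

theorem intervalIntegrable_clamp (a b : ℝ) : IntervalIntegrable clamp volume a b :=
  intervalIntegrable_of_bound measurable_clamp abs_clamp_le a b

theorem integral_clamp : ∫ x in (-1 : ℝ)..1, clamp x = 0 := by
  rw [intervalIntegral.integral_congr (g := fun x => x)]
  · simp
  · intro x hx
    rw [Set.uIcc_of_le (by norm_num)] at hx
    exact clamp_of_mem hx.1 hx.2

theorem measurable_ite_gt (y : ℝ) : Measurable fun x : ℝ => if x > y then (1 : ℝ) else 0 :=
  Measurable.ite measurableSet_Ioi measurable_const measurable_const

theorem intervalIntegrable_ite_gt (y a b : ℝ) :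
    IntervalIntegrable (fun x : ℝ => if x > y then (1 : ℝ) else 0) volume a b :=
  intervalIntegrable_of_bound (measurable_ite_gt y) (C := 1)
    (fun x => by split_ifs <;> simp) a b

/-- With `clamp` the formula holds for every real `y`, so the kernel is degenerate at every `y`
rather than almost every one. -/
theorem integral_ite_gt (y : ℝ) :
    ∫ x in (-1 : ℝ)..1, (if x > y then (1 : ℝ) else 0) = 1 - clamp y := by
  have h : (fun x : ℝ => if x > y then (1 : ℝ) else 0) = (Set.Ioi y).indicator 1 := by
    funext x; simp [Set.indicator_apply]
  rw [intervalIntegral.integral_of_le (by norm_num), h, integral_indicator_one measurableSet_Ioi,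
    measureReal_restrict_apply measurableSet_Ioi, Set.inter_comm, Set.Ioc_inter_Ioi,
    Real.volume_real_Ioc, clamp]
  rcases le_total y 1 with h | h
  · rw [min_eq_right h]
    rcases le_total (-1) y with h' | h' <;> simp [h', h]
  · rw [min_eq_left h]
    simp [h]

theorem integral_comp_sign_mul {s : ℝ} (hs : s = 1 ∨ s = -1) (φ : ℝ → ℝ) :
    ∫ x in (-1 : ℝ)..1, φ (s * x) = ∫ x in (-1 : ℝ)..1, φ x := by
  rcases hs with rfl | rfl
  · simp
  · simp only [neg_one_mul]
    rw [intervalIntegral.integral_comp_neg, neg_neg]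

/-- The centred indicator of `s * x > y`, minus its projections on `x` and on `y` when these are
uniform on `(-1, 1)` and `s` is a sign. -/
noncomputable def kernel (s x y : ℝ) : ℝ :=
  (if s * x > y then 1 else 0) - 1 / 2 - s * clamp x / 2 + clamp y / 2

theorem measurable_kernel (s : ℝ) : Measurable fun p : ℝ × ℝ => kernel s p.1 p.2 := by
  unfold kernel
  have h : Measurable fun p : ℝ × ℝ => if s * p.1 > p.2 then (1 : ℝ) else 0 :=
    Measurable.ite (measurableSet_lt measurable_snd (measurable_fst.const_mul s))
      measurable_const measurable_const
  exact ((h.sub_const _).sub (((measurable_clamp.comp measurable_fst).const_mul s).div_const 2)).add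
    ((measurable_clamp.comp measurable_snd).div_const 2)

theorem abs_kernel_le {s : ℝ} (hs : s = 1 ∨ s = -1) (x y : ℝ) : |kernel s x y| ≤ 2 := by
  have h1 := abs_le.1 (abs_clamp_le (s * x))
  have h2 := abs_le.1 (abs_clamp_le y)
  rw [kernel, ← clamp_sign_mul hs, abs_le]
  split_ifs <;> constructor <;> linarith [h1.1, h1.2, h2.1, h2.2]

theorem kernel_eq_kernel_one {s : ℝ} (hs : s = 1 ∨ s = -1) (x y : ℝ) :
    kernel s x y = kernel 1 (s * x) y := by
  simp only [kernel, clamp_sign_mul hs, one_mul]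

theorem integral_kernel_fst {s : ℝ} (hs : s = 1 ∨ s = -1) (y : ℝ) :
    ∫ x in (-1 : ℝ)..1, kernel s x y = 0 := by
  simp_rw [kernel_eq_kernel_one hs]
  rw [integral_comp_sign_mul hs fun x => kernel 1 x y]
  simp only [kernel, one_mul]
  have h1 := intervalIntegrable_ite_gt y (-1) 1
  have h2 : IntervalIntegrable (fun _ : ℝ => (1 / 2 : ℝ)) volume (-1) 1 := intervalIntegrable_const
  have h3 := (intervalIntegrable_clamp (-1) 1).div_const 2
  rw [intervalIntegral.integral_add ((h1.sub h2).sub h3) intervalIntegrable_const,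
    intervalIntegral.integral_sub (h1.sub h2) h3, intervalIntegral.integral_sub h1 h2,
    integral_ite_gt, intervalIntegral.integral_div 2 clamp, integral_clamp]
  simp
  ring

/-- The reflection `y ↦ -y` turns `s * x > -y` into `y > -(s * x)`, which exchanges the roles of the
two arguments. -/
theorem integral_kernel_snd {s : ℝ} (hs : s = 1 ∨ s = -1) (x : ℝ) :
    ∫ y in (-1 : ℝ)..1, kernel s x y = 0 := by
  have hneg : ∀ y, kernel s x (-y) = kernel 1 y (-(s * x)) := by
    intro y
    simp only [kernel, one_mul, clamp_neg, clamp_sign_mul hs]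
    have : (s * x > -y) ↔ (y > -(s * x)) := by constructor <;> intro h <;> linarith
    simp only [this]
    ring
  have h := integral_comp_sign_mul (Or.inr rfl) fun y => kernel s x y
  simp only [neg_one_mul, hneg] at h
  rw [← h]
  exact integral_kernel_fst (Or.inl rfl) _

/-- For `s = 1` the kernel is `(y - 1 - x) / 2` below `y` and `(y + 1 - x) / 2` above it. Shifting
the two pieces puts them side by side as the integral of `t ^ 2 / 4` over `(-1, 1)`, whatever `y`
is. -/
theorem integral_kernel_sq {s : ℝ} (hs : s = 1 ∨ s = -1) {y : ℝ} (hy1 : -1 ≤ y) (hy2 : y ≤ 1) :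
    ∫ x in (-1 : ℝ)..1, kernel s x y ^ 2 = 1 / 6 := by
  simp_rw [kernel_eq_kernel_one hs]
  rw [integral_comp_sign_mul hs fun x => kernel 1 x y ^ 2]
  have hm : Measurable fun x => kernel 1 x y ^ 2 :=
    ((measurable_kernel 1).comp measurable_prodMk_right).pow_const 2
  have hi := intervalIntegrable_of_bound hm (C := 2 ^ 2) (fun x => by
    rw [abs_pow]
    exact pow_le_pow_left₀ (abs_nonneg _) (abs_kernel_le (Or.inl rfl) x y) 2)
  rw [← intervalIntegral.integral_add_adjacent_intervals (hi (-1) y) (hi y 1)]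
  have h1 : ∫ x in (-1 : ℝ)..y, kernel 1 x y ^ 2 = ∫ x in (-1 : ℝ)..y, ((x - (y - 1)) ^ 2) / 4 := by
    refine intervalIntegral.integral_congr_ae (ae_of_all _ fun x hx => ?_)
    rw [Set.uIoc_of_le hy1] at hx
    rw [kernel, clamp_of_mem hy1 hy2, clamp_of_mem hx.1.le (hx.2.trans hy2), one_mul,
      if_neg (not_lt.2 hx.2)]
    ring
  have h2 : ∫ x in y..1, kernel 1 x y ^ 2 = ∫ x in y..1, ((x - (y + 1)) ^ 2) / 4 := by
    refine intervalIntegral.integral_congr_ae (ae_of_all _ fun x hx => ?_)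
    rw [Set.uIoc_of_le hy2] at hx
    rw [kernel, clamp_of_mem hy1 hy2, clamp_of_mem (hy1.trans hx.1.le) hx.2, one_mul,
      if_pos hx.1]
    ring
  rw [h1, h2, intervalIntegral.integral_div, intervalIntegral.integral_div,
    intervalIntegral.integral_comp_sub_right (fun x => x ^ 2),
    intervalIntegral.integral_comp_sub_right (fun x => x ^ 2), integral_pow, integral_pow]
  norm_num
  ring

theorem kernel_swap {x y : ℝ} (hxy : x ≠ y) : kernel 1 y x = -kernel 1 x y := by
  simp only [kernel, one_mul]
  rcases lt_or_gt_of_ne hxy with h | h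
  · rw [if_pos h, if_neg (not_lt.2 h.le)]; ring
  · rw [if_neg (not_lt.2 h.le), if_pos h]; ring

theorem kernel_neg_swap (x y : ℝ) : kernel (-1) y x = kernel (-1) x y := by
  have : (-1 * y > x) ↔ (-1 * x > y) := by constructor <;> intro h <;> linarith
  simp only [kernel, this]
  ring

/-- Off the diagonal `kernel 1` is antisymmetric, while `kernel (-1)` is symmetric. Their product is
antisymmetric, and by Fubini its integral over the square equals its own negative. -/
theorem integral_kernel_mul_kernel :
    ∫ y in (-1 : ℝ)..1, ∫ x in (-1 : ℝ)..1, kernel 1 x y * kernel (-1) x y = 0 := by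
  set K : ℝ → ℝ → ℝ := fun y x => kernel 1 x y * kernel (-1) x y with hK
  have hswap : ∀ x, ∫ y in (-1 : ℝ)..1, K y x = -∫ y in (-1 : ℝ)..1, K x y := by
    intro x
    rw [← intervalIntegral.integral_neg]
    refine intervalIntegral.integral_congr_ae ?_
    filter_upwards [compl_mem_ae_iff.2 (measure_singleton x)] with y hy _
    simp only [hK]
    rw [kernel_swap (Ne.symm (by simpa using hy) : x ≠ y).symm, kernel_neg_swap x y]
    ring
  have hmeas : Measurable fun p : ℝ × ℝ => K p.1 p.2 :=
    ((measurable_kernel 1).comp measurable_swap).mul ((measurable_kernel (-1)).comp measurable_swap)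
  have hfub : ∫ y in (-1 : ℝ)..1, ∫ x in (-1 : ℝ)..1, K y x =
      ∫ x in (-1 : ℝ)..1, ∫ y in (-1 : ℝ)..1, K y x := by
    simp only [intervalIntegral.integral_of_le (show (-1 : ℝ) ≤ 1 by norm_num)]
    refine integral_integral_swap (Integrable.of_bound hmeas.aestronglyMeasurable (2 * 2)
      (ae_of_all _ fun p => ?_))
    simp only [Function.uncurry, hK, norm_mul, Real.norm_eq_abs]
    exact mul_le_mul (abs_kernel_le (Or.inl rfl) _ _) (abs_kernel_le (Or.inr rfl) _ _)
      (abs_nonneg _) (by norm_num)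
  simp only [hswap, intervalIntegral.integral_neg] at hfub
  linarith

/-! ### The one-variable part -/

/-- The projection of the statistic on a single variable: `c / 2` times the variable, plus `b` times
the centred indicator of its being negative. -/
noncomputable def linKernel (c b x : ℝ) : ℝ :=
  c * clamp x / 2 + b * ((if x < 0 then 1 else 0) - 1 / 2)

theorem measurable_linKernel (c b : ℝ) : Measurable (linKernel c b) := by
  have h : Measurable fun x : ℝ => if x < 0 then (1 : ℝ) else 0 :=
    Measurable.ite measurableSet_Iio measurable_const measurable_const
  exact ((measurable_clamp.const_mul c).div_const 2).add ((h.sub_const _).const_mul b)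

theorem abs_linKernel_le (c b x : ℝ) : |linKernel c b x| ≤ |c| + |b| := by
  have h := abs_clamp_le x
  refine (abs_add_le _ _).trans (add_le_add ?_ ?_)
  · rw [abs_div, abs_mul, abs_two]
    nlinarith [abs_nonneg c]
  · rw [abs_mul]
    refine mul_le_of_le_one_right (abs_nonneg b) ?_
    split_ifs <;> norm_num [abs_le]

/-- The function is affine on each side of `0`; the cases `m = 1` and `m = 2` give the mean and the
second moment. -/
theorem integral_linKernel_pow (c b : ℝ) (m : ℕ) :
    ∫ x in (-1 : ℝ)..1, linKernel c b x ^ m =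
      (∫ x in (-1 : ℝ)..0, (c * x / 2 + b / 2) ^ m) + ∫ x in (0 : ℝ)..1, (c * x / 2 - b / 2) ^ m := by
  have hi := intervalIntegrable_of_bound ((measurable_linKernel c b).pow_const m)
    (C := (|c| + |b|) ^ m) (fun x => by
      rw [abs_pow]
      exact pow_le_pow_left₀ (abs_nonneg _) (abs_linKernel_le c b x) m)
  rw [← intervalIntegral.integral_add_adjacent_intervals (hi (-1) 0) (hi 0 1)]
  congr 1
  · refine intervalIntegral.integral_congr_ae ?_
    filter_upwards [compl_mem_ae_iff.2 (measure_singleton (0 : ℝ))] with x hx0 hx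
    rw [Set.uIoc_of_le (by norm_num)] at hx
    have : x < 0 := lt_of_le_of_ne hx.2 (by simpa using hx0)
    rw [linKernel, if_pos this, clamp_of_mem hx.1.le (by linarith)]
    ring
  · refine intervalIntegral.integral_congr_ae (ae_of_all _ fun x hx => ?_)
    rw [Set.uIoc_of_le (by norm_num)] at hx
    rw [linKernel, if_neg (not_lt.2 hx.1.le), clamp_of_mem (by linarith [hx.1]) hx.2]
    ring

theorem integral_const_mul_id (a b c : ℝ) : ∫ x in a..b, c * x = c * ((b ^ 2 - a ^ 2) / 2) := by
  rw [intervalIntegral.integral_const_mul, integral_id]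

theorem integral_linKernel (c b : ℝ) : ∫ x in (-1 : ℝ)..1, linKernel c b x = 0 := by
  have h := integral_linKernel_pow c b 1
  simp only [pow_one] at h
  rw [h, intervalIntegral.integral_add (Continuous.intervalIntegrable (by fun_prop) _ _)
    (Continuous.intervalIntegrable (by fun_prop) _ _), intervalIntegral.integral_sub
    (Continuous.intervalIntegrable (by fun_prop) _ _)
    (Continuous.intervalIntegrable (by fun_prop) _ _)]
  simp only [intervalIntegral.integral_div, integral_const_mul_id,
    intervalIntegral.integral_const, smul_eq_mul]
  ring

/-- Halved by the uniform density and taken at `b = 0` or `b = 1`, this is `linVar / 12`. -/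
theorem integral_linKernel_sq (c b : ℝ) :
    ∫ x in (-1 : ℝ)..1, linKernel c b x ^ 2 = (c ^ 2 - 3 * c * b + 3 * b ^ 2) / 6 := by
  have h1 : ∀ x : ℝ, (c * x / 2 + b / 2) ^ 2 = c ^ 2 / 4 * x ^ 2 + c * b / 2 * x + b ^ 2 / 4 := by
    intro x; ring
  have h2 : ∀ x : ℝ, (c * x / 2 - b / 2) ^ 2 = c ^ 2 / 4 * x ^ 2 - c * b / 2 * x + b ^ 2 / 4 := by
    intro x; ring
  rw [integral_linKernel_pow]
  simp only [h1, h2]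
  rw [intervalIntegral.integral_add (Continuous.intervalIntegrable (by fun_prop) _ _)
    (Continuous.intervalIntegrable (by fun_prop) _ _), intervalIntegral.integral_add
    (Continuous.intervalIntegrable (by fun_prop) _ _)
    (Continuous.intervalIntegrable (by fun_prop) _ _), intervalIntegral.integral_add
    (Continuous.intervalIntegrable (by fun_prop) _ _)
    (Continuous.intervalIntegrable (by fun_prop) _ _), intervalIntegral.integral_sub
    (Continuous.intervalIntegrable (by fun_prop) _ _)
    (Continuous.intervalIntegrable (by fun_prop) _ _)]
  simp only [integral_const_mul_id, intervalIntegral.integral_const_mul, integral_pow,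
    intervalIntegral.integral_const, smul_eq_mul]
  norm_num
  ring

/-! ### Orthogonality of the kernels and the exact variances -/

section UniformStatistic

variable {Ω : Type*} [MeasurableSpace Ω] {μ : Measure Ω} {n : ℕ} {U : Fin n → Ω → ℝ}

/-- The random variables `U k` are independent and uniformly distributed on `(-1, 1)`. -/
structure IsSymmUniform (U : Fin n → Ω → ℝ) (μ : Measure Ω) : Prop where
  measurable : ∀ k, Measurable (U k)
  indep : iIndepFun U μ
  law : ∀ k (φ : ℝ → ℝ), Measurable φ → ∫ ω, φ (U k ω) ∂μ = (∫ x in (-1 : ℝ)..1, φ x) / 2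

variable [IsProbabilityMeasure μ]

theorem IsSymmUniform.integral_pair (hU : IsSymmUniform U μ) {i j : Fin n} (hij : i ≠ j)
    {h : ℝ → ℝ → ℝ} (hh : Measurable fun p : ℝ × ℝ => h p.1 p.2) {C : ℝ}
    (hC : ∀ x y, ‖h x y‖ ≤ C) :
    ∫ ω, h (U i ω) (U j ω) ∂μ =
      (∫ y in (-1 : ℝ)..1, (∫ x in (-1 : ℝ)..1, h x y) / 2) / 2 := by
  have key := integral_comp_prod_of_indepFun (hU.measurable i) (hU.measurable j)
    (hU.indep.indepFun hij) (G := fun p => h p.1 p.2) hh (fun p => hC p.1 p.2)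
  simp only at key
  rw [key]
  have hin : ∀ y, ∫ ω, h (U i ω) y ∂μ = (∫ x in (-1 : ℝ)..1, h x y) / 2 := fun y =>
    hU.law i (fun x => h x y) (hh.comp measurable_prodMk_right)
  simp only [hin]
  refine hU.law j (fun y => (∫ x in (-1 : ℝ)..1, h x y) / 2) (Measurable.div_const ?_ 2)
  simp only [intervalIntegral.integral_of_le (show (-1 : ℝ) ≤ 1 by norm_num)]
  exact (hh.stronglyMeasurable.integral_prod_left'
    (μ := (volume : Measure ℝ).restrict (Set.Ioc (-1) 1))).measurable

/-- By `hab`, one of the kernel's two variables does not occur in the other factor. Integrating that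
variable out first gives zero, as the kernel is degenerate in both arguments. -/
theorem IsSymmUniform.integral_kernel_mul_eq_zero (hU : IsSymmUniform U μ) {s : ℝ}
    (hs : s = 1 ∨ s = -1) {i j a b : Fin n} (hij : i ≠ j)
    (hab : (i ≠ a ∧ i ≠ b) ∨ (j ≠ a ∧ j ≠ b)) {h : ℝ → ℝ → ℝ}
    (hh : Measurable fun p : ℝ × ℝ => h p.1 p.2) {C : ℝ} (hC : ∀ x y, ‖h x y‖ ≤ C) :
    ∫ ω, kernel s (U i ω) (U j ω) * h (U a ω) (U b ω) ∂μ = 0 := by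
  rcases hab with ⟨ha, hb⟩ | ⟨ha, hb⟩
  · refine integral_degenerate_mul_eq_zero hU.measurable hU.indep hij ha hb
      (measurable_kernel s) hh (abs_kernel_le hs) hC fun y => ?_
    rw [hU.law i (fun x => kernel s x y) ((measurable_kernel s).comp measurable_prodMk_right),
      integral_kernel_fst hs, zero_div]
  · refine integral_degenerate_mul_eq_zero (g := fun x y => kernel s y x) hU.measurable hU.indep
      hij.symm ha hb ((measurable_kernel s).comp measurable_swap) hh
      (fun x y => abs_kernel_le hs y x) hC fun y => ?_
    rw [hU.law j (fun x => kernel s y x) ((measurable_kernel s).comp measurable_prodMk_left),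
      integral_kernel_snd hs, zero_div]

theorem norm_kernel_mul_kernel_le {s t : ℝ} (hs : s = 1 ∨ s = -1) (ht : t = 1 ∨ t = -1)
    (x y : ℝ) : ‖kernel s x y * kernel t x y‖ ≤ 2 * 2 := by
  rw [norm_mul]
  exact mul_le_mul (abs_kernel_le hs _ _) (abs_kernel_le ht _ _) (abs_nonneg _) (by norm_num)

theorem IsSymmUniform.integral_kernel_sq (hU : IsSymmUniform U μ) {s : ℝ}
    (hs : s = 1 ∨ s = -1) {i j : Fin n} (hij : i ≠ j) :
    ∫ ω, kernel s (U i ω) (U j ω) * kernel s (U i ω) (U j ω) ∂μ = 1 / 12 := by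
  rw [hU.integral_pair hij (h := fun x y => kernel s x y * kernel s x y)
    ((measurable_kernel s).mul (measurable_kernel s)) (norm_kernel_mul_kernel_le hs hs)]
  rw [intervalIntegral.integral_congr (g := fun _ => 1 / 12)]
  · norm_num
  · intro y hy
    rw [Set.uIcc_of_le (by norm_num)] at hy
    simp only [← pow_two]
    rw [_root_.integral_kernel_sq hs hy.1 hy.2]
    norm_num

theorem IsSymmUniform.integral_kernel_mul_kernel (hU : IsSymmUniform U μ) {i j : Fin n}
    (hij : i ≠ j) :
    ∫ ω, kernel 1 (U i ω) (U j ω) * kernel (-1) (U i ω) (U j ω) ∂μ = 0 := by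
  rw [hU.integral_pair hij (h := fun x y => kernel 1 x y * kernel (-1) x y)
    ((measurable_kernel 1).mul (measurable_kernel (-1)))
    (norm_kernel_mul_kernel_le (Or.inl rfl) (Or.inr rfl)), intervalIntegral.integral_div,
    _root_.integral_kernel_mul_kernel]
  simp

/-- The positive roots that contribute to the statistic: `e_i - e_j` for pairs in the left summand
and `e_i + e_j` for pairs in the right one. -/
def rootSet (n d e : ℕ) : Finset ((Fin n × Fin n) ⊕ (Fin n × Fin n)) :=
  (diffPairs n d).disjSum (sumPairs n e)

/-- The degenerate kernel of a root. -/
noncomputable def rootKernel : (Fin n × Fin n) ⊕ (Fin n × Fin n) → (Fin n → ℝ) → ℝ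
  | .inl p, z => kernel 1 (z p.1) (z p.2)
  | .inr p, z => kernel (-1) (z p.1) (z p.2)

theorem rootKernel_eq (q : (Fin n × Fin n) ⊕ (Fin n × Fin n)) :
    ∃ s : ℝ, (s = 1 ∨ s = -1) ∧ ∀ z : Fin n → ℝ,
      rootKernel q z = kernel s (z (q.elim id id).1) (z (q.elim id id).2) := by
  rcases q with p | p
  · exact ⟨1, Or.inl rfl, fun _ => rfl⟩
  · exact ⟨-1, Or.inr rfl, fun _ => rfl⟩

theorem fst_lt_snd_of_mem_rootSet {d e : ℕ} {q : (Fin n × Fin n) ⊕ (Fin n × Fin n)}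
    (hq : q ∈ rootSet n d e) : (q.elim id id).1 < (q.elim id id).2 := by
  rcases q with p | p
  · exact (Finset.mem_filter.1 (Finset.inl_mem_disjSum.1 hq)).2.1
  · exact (Finset.mem_filter.1 (Finset.inr_mem_disjSum.1 hq)).2.1

theorem abs_rootKernel_le (q : (Fin n × Fin n) ⊕ (Fin n × Fin n)) (z : Fin n → ℝ) :
    |rootKernel q z| ≤ 2 := by
  obtain ⟨s, hs, h⟩ := rootKernel_eq q
  rw [h]
  exact abs_kernel_le hs _ _

theorem measurable_rootKernel (hU : ∀ k, Measurable (U k))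
    (q : (Fin n × Fin n) ⊕ (Fin n × Fin n)) :
    Measurable fun ω => rootKernel q fun k => U k ω := by
  obtain ⟨s, -, h⟩ := rootKernel_eq q
  simp only [h]
  exact (measurable_kernel s).comp ((hU _).prodMk (hU _))

theorem memLp_rootKernel (hU : ∀ k, Measurable (U k))
    (q : (Fin n × Fin n) ⊕ (Fin n × Fin n)) :
    MemLp (fun ω => rootKernel q fun k => U k ω) 2 μ :=
  memLp_two_of_bound (measurable_rootKernel hU q) ⟨2, fun _ => abs_rootKernel_le q _⟩

theorem IsSymmUniform.integral_rootKernel_mul_comp (hU : IsSymmUniform U μ)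
    {q : (Fin n × Fin n) ⊕ (Fin n × Fin n)} (hq : (q.elim id id).1 < (q.elim id id).2)
    (k : Fin n) {φ : ℝ → ℝ} (hφ : Measurable φ) {C : ℝ} (hC : ∀ x, ‖φ x‖ ≤ C) :
    ∫ ω, (rootKernel q fun k => U k ω) * φ (U k ω) ∂μ = 0 := by
  obtain ⟨s, hs, h⟩ := rootKernel_eq q
  simp only [h]
  -- `φ` is read as a function of two variables, both at index `k`; at most one entry of the pair
  -- equals `k`, which leaves the other free.
  refine hU.integral_kernel_mul_eq_zero hs hq.ne (b := k) (h := fun x _ => φ x) ?_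
    (hφ.comp measurable_fst) fun x _ => hC x
  by_cases hk : (q.elim id id).1 = k
  · exact Or.inr ⟨fun h' => hq.ne (hk.trans h'.symm), fun h' => hq.ne (hk.trans h'.symm)⟩
  · exact Or.inl ⟨hk, hk⟩

/-- Distinct roots either share their pair of indices with opposite signs, where antisymmetry
applies, or have different pairs, where one index of `q` is missing from `r`. -/
theorem IsSymmUniform.integral_rootKernel_mul_rootKernel (hU : IsSymmUniform U μ)
    {q r : (Fin n × Fin n) ⊕ (Fin n × Fin n)} (hq : (q.elim id id).1 < (q.elim id id).2)
    (hr : (r.elim id id).1 < (r.elim id id).2) :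
    ∫ ω, (rootKernel q fun k => U k ω) * (rootKernel r fun k => U k ω) ∂μ =
      if q = r then 1 / 12 else 0 := by
  obtain ⟨s, hs, h⟩ := rootKernel_eq q
  obtain ⟨t, ht, h'⟩ := rootKernel_eq r
  split_ifs with hqr
  · subst hqr
    simp only [h]
    exact hU.integral_kernel_sq hs hq.ne
  · by_cases hp : q.elim id id = r.elim id id
    · rcases q with q | q <;> rcases r with r | r <;>
        simp only [Sum.elim_inl, Sum.elim_inr, id] at hp hq hr <;> subst hp
      · exact absurd rfl hqr
      · exact hU.integral_kernel_mul_kernel hq.ne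
      · simp only [mul_comm (rootKernel (Sum.inr q) _)]
        exact hU.integral_kernel_mul_kernel hq.ne
      · exact absurd rfl hqr
    · simp only [h, h']
      refine hU.integral_kernel_mul_eq_zero hs hq.ne ?_ (measurable_kernel t) (abs_kernel_le ht)
      -- Both pairs are increasing, so distinct pairs are distinct as sets and some entry of the
      -- first is absent from the second.
      generalize q.elim id id = a at *
      generalize r.elim id id = b at *
      obtain ⟨a1, a2⟩ := a
      obtain ⟨b1, b2⟩ := b
      simp only [Prod.mk.injEq, ne_eq, Fin.ext_iff, Fin.lt_def] at *
      omega

/-- The indicator that the `k`-th index is counted by `negCount`. -/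
def negCoeff (n f : ℕ) (k : Fin n) : ℝ := if (k : ℕ) + 1 ≤ f then 1 else 0

/-- The statistic that counts the sign changes at roots `e_i - e_j`, `e_i + e_j` and `e_i`. -/
noncomputable def rootInv (n d e f : ℕ) (z : Fin n → ℝ) : ℝ :=
  diffInv n d z + sumInv n e z + negCount n f z

/-- Each pair indicator is its mean `1/2`, plus its two projections, plus its kernel. Collecting the
projections index by index produces `linCoeff`. -/
theorem rootInv_eq (n d e f : ℕ) : ∃ m : ℝ, ∀ z : Fin n → ℝ, rootInv n d e f z =
    m + ∑ k, linKernel (linCoeff n d e k) (negCoeff n f k) (z k)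
      + ∑ q ∈ rootSet n d e, rootKernel q z := by
  refine ⟨(diffPairs n d).card * (1 / 2) + (sumPairs n e).card * (1 / 2)
    + ∑ k, negCoeff n f k * (1 / 2), fun z => ?_⟩
  have h1 : diffInv n d z = ∑ p ∈ diffPairs n d,
      (1 / 2 + clamp (z p.1) / 2 - clamp (z p.2) / 2 + kernel 1 (z p.1) (z p.2)) := by
    refine Finset.sum_congr rfl fun p _ => ?_
    simp only [kernel, one_mul]
    ring
  have h2 : sumInv n e z = ∑ p ∈ sumPairs n e,
      (1 / 2 - clamp (z p.1) / 2 - clamp (z p.2) / 2 + kernel (-1) (z p.1) (z p.2)) := by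
    refine Finset.sum_congr rfl fun p _ => ?_
    simp only [kernel, neg_one_mul]
    ring
  have h3 : negCount n f z = ∑ k, negCoeff n f k * (if z k < 0 then 1 else 0) := by
    rw [negCount, Finset.sum_filter]
    refine Finset.sum_congr rfl fun k _ => ?_
    by_cases hk : (k : ℕ) + 1 ≤ f <;> simp [negCoeff, hk]
  rw [rootInv, h1, h2, h3, rootSet, Finset.sum_disjSum]
  simp only [Finset.sum_add_distrib, Finset.sum_sub_distrib, linKernel, rootKernel,
    sum_fst_eq _ fun k => clamp (z k) / 2, sum_snd_eq _ fun k => clamp (z k) / 2,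
    Finset.sum_const, nsmul_eq_mul, mul_sub]
  have h4 : ∑ k, linCoeff n d e k * clamp (z k) / 2 =
      ∑ k, (fstCount (diffPairs n d) k : ℝ) * (clamp (z k) / 2)
      - ∑ k, (sndCount (diffPairs n d) k : ℝ) * (clamp (z k) / 2)
      - ∑ k, (fstCount (sumPairs n e) k : ℝ) * (clamp (z k) / 2)
      - ∑ k, (sndCount (sumPairs n e) k : ℝ) * (clamp (z k) / 2) := by
    simp only [← Finset.sum_sub_distrib]
    refine Finset.sum_congr rfl fun k _ => ?_
    rw [linCoeff]
    ring
  rw [h4]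
  ring

theorem IsSymmUniform.variance_rootInv (hU : IsSymmUniform U μ) (d e f : ℕ) :
    variance (hajekProjection μ U fun ω => rootInv n d e f fun k => U k ω) μ =
        (∑ k, linVar n d e f k) / 12 ∧
      variance (fun ω => rootInv n d e f fun k => U k ω) μ =
        (∑ k, linVar n d e f k) / 12 +
          ((diffPairs n d).card + (sumPairs n e).card : ℝ) / 12 := by
  obtain ⟨m, hm⟩ := rootInv_eq n d e f
  simp only [hm]
  set F : Fin n → ℝ → ℝ := fun k => linKernel (linCoeff n d e k) (negCoeff n f k) with hF
  set R : Ω → ℝ := fun ω => ∑ q ∈ rootSet n d e, rootKernel q fun k => U k ω with hR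
  have hFm : ∀ k, Measurable (F k) := fun k => measurable_linKernel _ _
  have hFC : ∀ k, ∃ C, ∀ x, ‖F k x‖ ≤ C := fun k => ⟨_, abs_linKernel_le _ _⟩
  have hF0 : ∀ k, ∫ ω, F k (U k ω) ∂μ = 0 := fun k => by
    rw [hU.law k (F k) (hFm k), integral_linKernel, zero_div]
  have hF2 : ∀ k, ∫ ω, F k (U k ω) ^ 2 ∂μ = linVar n d e f k / 12 := fun k => by
    rw [hU.law k (fun x => F k x ^ 2) ((hFm k).pow_const 2), integral_linKernel_sq, linVar,
      negCoeff]
    split_ifs <;> ring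
  have hRm : Measurable R :=
    Finset.measurable_sum _ fun q _ => measurable_rootKernel hU.measurable q
  have hRC : ∃ C, ∀ ω, ‖R ω‖ ≤ C := ⟨∑ q ∈ rootSet n d e, 2, fun ω =>
    norm_sum_le_of_le _ fun q _ => abs_rootKernel_le q _⟩
  have hRφ : ∀ k (φ : ℝ → ℝ), Measurable φ → (∃ C, ∀ x, ‖φ x‖ ≤ C) →
      ∫ ω, R ω * φ (U k ω) ∂μ = 0 := by
    rintro k φ hφ ⟨C, hC⟩
    have hφL : MemLp (fun ω => φ (U k ω)) 2 μ :=
      memLp_two_of_bound (hφ.comp (hU.measurable k)) ⟨C, fun ω => hC _⟩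
    have hi : ∀ q ∈ rootSet n d e,
        Integrable (fun ω => (rootKernel q fun k => U k ω) * φ (U k ω)) μ := fun q _ =>
      (memLp_rootKernel hU.measurable q).integrable_mul hφL
    simp only [hR, Finset.sum_mul]
    rw [integral_finsetSum _ hi]
    exact Finset.sum_eq_zero fun q hq =>
      hU.integral_rootKernel_mul_comp (fst_lt_snd_of_mem_rootSet hq) k hφ hC
  have hRint : ∫ ω, R ω ∂μ = 0 := by
    rw [integral_finsetSum _ fun q _ =>
      (memLp_rootKernel hU.measurable q).integrable one_le_two]
    refine Finset.sum_eq_zero fun q hq => ?_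
    simpa using hU.integral_rootKernel_mul_comp (fst_lt_snd_of_mem_rootSet hq)
      (q.elim id id).1 (φ := fun _ => 1) measurable_const (C := 1) (by simp)
  have hR2 : ∫ ω, R ω ^ 2 ∂μ = ((diffPairs n d).card + (sumPairs n e).card : ℝ) / 12 := by
    have hi : ∀ q r, Integrable
        (fun ω => (rootKernel q fun k => U k ω) * (rootKernel r fun k => U k ω)) μ := fun q r =>
      (memLp_rootKernel hU.measurable q).integrable_mul (memLp_rootKernel hU.measurable r)
    simp only [hR, pow_two, Finset.sum_mul_sum]
    rw [integral_finsetSum _ fun q _ => integrable_finsetSum _ fun r _ => hi q r]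
    have : ∀ q ∈ rootSet n d e, ∫ ω, ∑ r ∈ rootSet n d e,
        (rootKernel q fun k => U k ω) * (rootKernel r fun k => U k ω) ∂μ = 1 / 12 := by
      intro q hq
      rw [integral_finsetSum _ fun r _ => hi q r]
      rw [Finset.sum_congr rfl fun r hr => hU.integral_rootKernel_mul_rootKernel
        (fst_lt_snd_of_mem_rootSet hq) (fst_lt_snd_of_mem_rootSet hr)]
      simp [hq]
    rw [Finset.sum_congr rfl this, Finset.sum_const, rootSet, Finset.card_disjSum, nsmul_eq_mul]
    push_cast
    ring
  constructor
  · rw [variance_congr (hajekProjection_hoeffding hU.measurable hU.indep hFm hFC hF0 hRm hRC hRφ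
      hRint)]
    -- The projection is itself such a decomposition, with zero remainder.
    have h := variance_hoeffding (m := m) (R := fun _ => (0 : ℝ)) hU.measurable hU.indep hFm hFC
      hF0 measurable_const ⟨0, by simp⟩ (by simp) (by simp)
    simp only [add_zero, hF2] at h
    rw [h]
    simp [Finset.sum_div]
  · rw [variance_hoeffding hU.measurable hU.indep hFm hFC hF0 hRm hRC hRφ hRint, hR2]
    simp only [hF2, Finset.sum_div]

end UniformStatistic

/-! ### Reduction of the three families to one statistic -/

section Weyl

variable {Ω : Type*} [MeasurableSpace Ω] {μ : Measure Ω} {n : ℕ}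

theorem integral_comp_of_isUniform {Z : Ω → ℝ} (hZ : Measurable Z) {a b : ℝ} (hab : a < b)
    (hu : pdf.IsUniform Z (Set.Ioo a b) μ volume) {φ : ℝ → ℝ} (hφ : Measurable φ) :
    ∫ ω, φ (Z ω) ∂μ = (∫ x in a..b, φ x) / (b - a) := by
  rw [← integral_map hZ.aemeasurable hφ.aestronglyMeasurable, hu, ProbabilityTheory.cond,
    integral_smul_measure, intervalIntegral.integral_of_le hab.le, integral_Ioc_eq_integral_Ioo,
    Real.volume_Ioo, ENNReal.toReal_inv, ENNReal.toReal_ofReal (by linarith), smul_eq_mul]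
  ring

theorem isSymmUniform_of_isUniform {Z : Fin n → Ω → ℝ} (hZ : ∀ k, Measurable (Z k))
    (hind : iIndepFun Z μ) (hu : ∀ k, pdf.IsUniform (Z k) (Set.Ioo (-1) 1) μ volume) :
    IsSymmUniform Z μ where
  measurable := hZ
  indep := hind
  law k φ hφ := by
    rw [integral_comp_of_isUniform (hZ k) (by norm_num) (hu k) hφ]
    norm_num

theorem isSymmUniform_two_mul_sub_one {Z : Fin n → Ω → ℝ} (hZ : ∀ k, Measurable (Z k))
    (hind : iIndepFun Z μ) (hu : ∀ k, pdf.IsUniform (Z k) (Set.Ioo 0 1) μ volume) :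
    IsSymmUniform (fun k ω => 2 * Z k ω - 1) μ where
  measurable k := ((hZ k).const_mul 2).sub_const 1
  indep := hind.comp (fun _ x => 2 * x - 1) fun _ => (measurable_id.const_mul 2).sub_const 1
  law k φ hφ := by
    rw [integral_comp_of_isUniform (hZ k) (by norm_num) (hu k) (φ := fun x => φ (2 * x - 1))
      (hφ.comp ((measurable_id.const_mul 2).sub_const 1)),
      intervalIntegral.integral_comp_mul_sub _ two_ne_zero]
    norm_num
    ring

/-- Rescaling `(0, 1)` to `(-1, 1)` is invertible, so it leaves the conditioning σ-algebras, and
with them the Hájek projection, unchanged. -/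
theorem comap_two_mul_sub_one {Ω : Type*} (Z : Ω → ℝ) :
    MeasurableSpace.comap (fun ω => 2 * Z ω - 1) (borel ℝ) = MeasurableSpace.comap Z (borel ℝ) := by
  have h : MeasurableSpace.comap (fun x : ℝ => 2 * x - 1) (borel ℝ) = borel ℝ := by
    refine le_antisymm (Measurable.comap_le ?_) fun s hs => ?_
    · exact (measurable_id.const_mul (2 : ℝ)).sub_const 1
    · refine ⟨(fun x : ℝ => (x + 1) / 2) ⁻¹' s, ?_, ?_⟩
      · have : Measurable fun x : ℝ => (x + 1) / 2 := by fun_prop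
        exact this hs
      · ext x
        simp
  have h2 : (fun ω => 2 * Z ω - 1) = (fun x : ℝ => 2 * x - 1) ∘ Z := rfl
  rw [h2, ← MeasurableSpace.comap_comp, h]

/-- The bound on the height of the roots `e_i + e_j` that are counted in a family. -/
def WeylFamily.sumHeight : WeylFamily → ℕ → ℕ
  | S, _ => 0
  | B, d => d
  | D, d => d + 2

/-- The bound on the index of the roots `e_i` that are counted in a family. -/
def WeylFamily.negHeight : WeylFamily → ℕ → ℕ
  | S, _ => 0
  | B, d => d
  | D, _ => 0

theorem negCount_zero (n : ℕ) (z : Fin n → ℝ) : negCount n 0 z = 0 := by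
  simp [negCount]

theorem sumInv_zero (n : ℕ) (z : Fin n → ℝ) : sumInv n 0 z = 0 := by
  simp [sumInv, sumPairs]

theorem diffInv_two_mul_sub_one (n d : ℕ) (z : Fin n → ℝ) :
    diffInv n d (fun k => 2 * z k - 1) = diffInv n d z := by
  simp [diffInv]

theorem variance_genInv [IsProbabilityMeasure μ] (W : WeylFamily) (d : ℕ) {Z : Fin n → Ω → ℝ}
    (hZ : ∀ k, Measurable (Z k)) (hind : iIndepFun Z μ)
    (hu : ∀ k, pdf.IsUniform (Z k) W.range μ volume) :
    variance (hajekProjection μ Z fun ω => genInv W n d fun k => Z k ω) μ =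
        (∑ k, linVar n d (W.sumHeight d) (W.negHeight d) k) / 12 ∧
      variance (fun ω => genInv W n d fun k => Z k ω) μ =
        (∑ k, linVar n d (W.sumHeight d) (W.negHeight d) k) / 12 +
          ((diffPairs n d).card + (sumPairs n (W.sumHeight d)).card : ℝ) / 12 := by
  cases W with
  | S =>
    have h := (isSymmUniform_two_mul_sub_one hZ hind hu).variance_rootInv d 0 0
    have hX : ∀ z : Fin n → ℝ, rootInv n d 0 0 (fun k => 2 * z k - 1) = genInv .S n d z := by
      intro z
      rw [rootInv, sumInv_zero, negCount_zero, diffInv_two_mul_sub_one, genInv]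
      ring
    have hX' : ∀ ω, rootInv n d 0 0 (fun k => 2 * Z k ω - 1) = genInv .S n d fun k => Z k ω :=
      fun ω => hX _
    simp only [hX'] at h
    have hh : ∀ X : Ω → ℝ, hajekProjection μ (fun k ω => 2 * Z k ω - 1) X =
        hajekProjection μ Z X := by
      intro X
      unfold hajekProjection
      simp only [comap_two_mul_sub_one]
    rw [hh] at h
    exact h
  | B => exact (isSymmUniform_of_isUniform hZ hind hu).variance_rootInv d d d
  | D =>
    have h := (isSymmUniform_of_isUniform hZ hind hu).variance_rootInv d (d + 2) 0
    simp only [rootInv, negCount_zero, add_zero] at h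
    exact h

end Weyl

/-! ### Comparison of `n * d` with `d ^ 3` -/

/-- The equivalence says `q = o(v + q)`. The upper bound on `v` yields the forward direction. The
lower bound yields the converse, where `8 ≤ d n` holds eventually because `√n = o(d)` forces `d` to
infinity. -/
theorem isEquivalent_add_iff_isLittleO_sqrt {v q : ℕ → ℝ} {d : ℕ → ℕ} {C c : ℝ} (hC : 0 < C)
    (hc : 0 < c) (hd : ∀ᶠ n in atTop, 1 ≤ d n)
    (hq : ∀ᶠ n : ℕ in atTop, c * (n * d n) ≤ q n ∧ q n ≤ C * (n * d n))
    (hv : ∀ᶠ n in atTop, 0 ≤ v n ∧ v n ≤ C * (d n : ℝ) ^ 3)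
    (hv' : ∀ᶠ n in atTop, 8 ≤ d n → c * (d n : ℝ) ^ 3 ≤ v n) :
    v ~[atTop] (fun n => v n + q n) ↔
      (fun n : ℕ => √(n : ℝ)) =o[atTop] (fun n => (d n : ℝ)) := by
  have hsub : (v - fun n => v n + q n) = fun n => -q n := by
    funext n; simp
  rw [IsEquivalent, hsub, isLittleO_neg_left]
  constructor
  · intro h
    rw [isLittleO_iff]
    intro ε hε
    -- The bound `1 / 2` lets `δ * q` be absorbed, so that `q ≤ 2 * δ * v`; the other gives `2 * δ *
    -- C ≤ ε ^ 2 * c`, whence `n ≤ (ε * d) ^ 2` after dividing by `c * d`.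
    set δ : ℝ := min (1 / 2) (ε ^ 2 * c / (2 * C)) with hδ
    have hδ0 : 0 < δ := by positivity
    filter_upwards [isLittleO_iff.1 h hδ0, hd, hq, hv] with n hn hd hq hv
    have hd' : (1 : ℝ) ≤ d n := by exact_mod_cast hd
    have hq0 : 0 ≤ q n := le_trans (by positivity) hq.1
    rw [Real.norm_of_nonneg hq0, Real.norm_of_nonneg (add_nonneg hv.1 hq0)] at hn
    rw [Real.norm_of_nonneg (Real.sqrt_nonneg _), Real.norm_of_nonneg (by positivity)]
    refine Real.sqrt_le_iff.2 ⟨by positivity, ?_⟩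
    have h1 : q n ≤ 2 * δ * v n := by
      have : δ * q n ≤ 1 / 2 * q n := mul_le_mul_of_nonneg_right (min_le_left _ _) hq0
      linarith
    have h2 : 2 * δ * v n ≤ 2 * δ * (C * (d n : ℝ) ^ 3) := by gcongr; exact hv.2
    have h3 : 2 * δ * C ≤ ε ^ 2 * c := by
      have := min_le_right (1 / 2) (ε ^ 2 * c / (2 * C))
      rw [← hδ, le_div_iff₀ (by positivity)] at this
      linarith
    have h4 : 2 * δ * C * (d n : ℝ) ^ 3 ≤ ε ^ 2 * c * (d n : ℝ) ^ 3 := by gcongr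
    have h5 : (c * d n) * n ≤ (c * d n) * (ε * d n) ^ 2 := by linarith [hq.1]
    exact le_of_mul_le_mul_left h5 (by positivity)
  · intro h
    have hdtop : ∀ᶠ n in atTop, 8 ≤ d n := by
      filter_upwards [isLittleO_iff.1 h (show (0 : ℝ) < 1 / 8 by norm_num),
        eventually_ge_atTop 1] with n hn hn1
      rw [Real.norm_of_nonneg (Real.sqrt_nonneg _), Real.norm_of_nonneg (by positivity)] at hn
      have h1 : (1 : ℝ) ≤ √n := Real.one_le_sqrt.2 (by exact_mod_cast hn1)
      have : (8 : ℝ) ≤ d n := by linarith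
      exact_mod_cast this
    rw [isLittleO_iff]
    intro ε hε
    -- Chosen so that `C * δ ^ 2 = ε * c`: then `n ≤ (δ * d) ^ 2` turns `C * n * d` into `ε * c * d
    -- ^ 3`.
    set δ : ℝ := √(ε * c / C) with hδ
    have hδ0 : 0 < δ := Real.sqrt_pos.2 (by positivity)
    have hδ2 : δ ^ 2 = ε * c / C := Real.sq_sqrt (by positivity)
    filter_upwards [isLittleO_iff.1 h hδ0, hdtop, hq, hv, hv'] with n hn hd hq hv hv'
    have hq0 : 0 ≤ q n := le_trans (by positivity) hq.1
    rw [Real.norm_of_nonneg hq0, Real.norm_of_nonneg (add_nonneg hv.1 hq0)]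
    rw [Real.norm_of_nonneg (Real.sqrt_nonneg _), Real.norm_of_nonneg (by positivity)] at hn
    have h1 : (n : ℝ) ≤ (δ * d n) ^ 2 := (Real.sqrt_le_iff.1 hn).2
    calc q n ≤ C * (n * d n) := hq.2
      _ ≤ C * ((δ * d n) ^ 2 * d n) := by gcongr
      _ = ε * (c * (d n : ℝ) ^ 3) := by rw [mul_pow, hδ2]; field_simp
      _ ≤ ε * v n := by gcongr; exact hv' hd
      _ ≤ ε * (v n + q n) := by gcongr; linarith

theorem lemma3p1
    (W : ℕ → WeylFamily) (d : ℕ → ℕ)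
    (hd : ∀ᶠ n in atTop, 1 ≤ d n ∧ d n ≤ (W n).dMax n - 1)
    {Ω : ℕ → Type*} [∀ n, MeasurableSpace (Ω n)]
    (μ : ∀ n, Measure (Ω n)) [∀ n, IsProbabilityMeasure (μ n)]
    (Z : ∀ n, Fin n → Ω n → ℝ)
    (hZ_meas : ∀ n k, Measurable (Z n k))
    (hZ_indep : ∀ n, iIndepFun (Z n) (μ n))
    (hZ_unif : ∀ n k, pdf.IsUniform (Z n k) (W n).range (μ n) volume) :
    let X : ∀ n, Ω n → ℝ := fun n ω => genInv (W n) n (d n) (fun k => Z n k ω)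
    (fun n => variance (hajekProjection (μ n) (Z n) (X n)) (μ n))
        ~[atTop] (fun n => variance (X n) (μ n)) ↔
      (fun n : ℕ => √(n : ℝ)) =o[atTop] (fun n => (d n : ℝ)) := by
  intro X
  have hvar := fun n => variance_genInv (W n) (d n) (hZ_meas n) (hZ_indep n) (hZ_unif n)
  have h1 := fun n => (hvar n).1
  have h2 := fun n => (hvar n).2
  simp only [X, h1, h2]
  have hdn : ∀ᶠ n in atTop, d n ≤ 2 * n := by
    filter_upwards [hd] with n hn
    refine hn.2.trans ?_
    cases W n <;> simp only [WeylFamily.dMax] <;> omega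
  have hsum : ∀ n, (W n).sumHeight (d n) ≤ d n + 2 := fun n => by
    cases W n <;> simp [WeylFamily.sumHeight]
  have hneg : ∀ n, (W n).negHeight (d n) ≤ d n := fun n => by
    cases W n <;> simp [WeylFamily.negHeight]
  -- `25` exceeds both `292 / 12` and `4 / 12`; `1 / 6144` is `1 / (512 * 12)` and lies below `1 /
  -- (16 * 12)`.
  refine isEquivalent_add_iff_isLittleO_sqrt (C := 25) (c := 1 / 6144) (by norm_num) (by norm_num)
    (hd.mono fun n hn => hn.1) ?_ ?_ ?_
  · filter_upwards [hd, hdn, eventually_ge_atTop 2] with n hd hdn hn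
    have hu := card_diffPairs_add_card_sumPairs_le (n := n) (hsum n) hd.1
    have hl := le_card_diffPairs hdn hn
    have h0 : (0 : ℝ) ≤ n * d n := by positivity
    have h0' : (0 : ℝ) ≤ (sumPairs n ((W n).sumHeight (d n))).card := by positivity
    constructor <;> linarith
  · filter_upwards [hd] with n hd
    have hu := sum_linVar_le (n := n) (hsum n) (hneg n) hd.1
    have h0 : (0 : ℝ) ≤ (d n : ℝ) ^ 3 := by positivity
    exact ⟨div_nonneg (Finset.sum_nonneg fun k _ => linVar_nonneg _ _ _ _ _) (by norm_num),
      by linarith⟩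
  · filter_upwards [hdn] with n hdn hd8
    have hl := le_sum_linVar (e := (W n).sumHeight (d n)) (f := (W n).negHeight (d n)) hdn hd8
    linarith
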